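/- Consider a tandem queue with two nodes. Customers arrive at node 1 in a Poisson process of rate $\lambda>0$, are served at node 1, then at node 2, and leave. Let $A=[0,a_{\max}]$ and $B=[0,b_{\max}]$. When $a\in A$ resources are used at node 1 and $b\in B$ at node 2, the service rates are $\mu_1(a)$ and $\mu_2(b)$ and resource costs are incurred at rates $c_1(a)$ and $c_2(b)$. Each $\mu_i$ is strictly increasing with $\mu_i(0)=0$; each $c_i$ is continuous and strictly increasing with $c_i(0)=0$. Holding costs are incurred at rate $h_i\ge 0$ per customer at node $i$. Assume $\lambda<\mu_1(a_{\max})$ and $\lambda<\mu_2(b_{\max})$, and normalize $\lambda+\mu_1(a_{\max})+\mu_2(b_{\max})=1$. For a function $v$ on the states $x=(x_1,x_2)\in\mathbb N^2$ (numbers of customers at the nodes) put $$T_1v(x)=\min_{a\in A}\{\mu_1(a)v(x-e_1+e_2)+[\mu_1(a_{\max})-\mu_1(a)]v(x)+c_1(a)\},$$ $$T_2v(x)=\min_{b\in B}\{\mu_2(b)v(x-e_2)+[\mu_2(b_{\max})-\mu_2(b)]v(x)+c_2(b)\},$$ $$Tv(x)=\lambda v(x+e_1)+T_1v(x)+T_2v(x)+h_1x_1+h_2x_2,$$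 where $x-e_1+e_2$ is replaced by $x$ if $x_1=0$, and $x-e_2$ is replaced by $x$ if $x_2=0$ (dummy transitions; where a minimum is not attained it is read as the infimum). Let $\arg T_iv(x)$ be the set of all minimizers in the definition of $T_iv(x)$. Let $v_0=0$, $v_{n+1}=Tv_n$, and let $v:\mathbb N^2\to\mathbb R$ be the relative value function of the long-run average cost problem: for some $g\in\mathbb R$ one has $Tv=v+g$, and $v(x)-v(0)=\lim_{n\to\infty}\,[v_n(x)-v_n(0)]$ for every $x$. Then the optimal allocations are monotone in the node's own queue length. For every $x\in\mathbb N^2$: (i) if $b_1\in\arg T_2v(x+e_2)$ and $b_2\in\arg T_2v(x)$, then $b_1\ge b_2$; (ii) if $a_1\in\arg T_1v(x+e_1)$ and $a_2\in\arg T_1v(x)$, then $a_1\ge a_2$. -/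

import Mathlib

open Set Filter Topology

/-- The data of the two-node tandem queue with controllable service resources, with time scaled so
that the uniformization rate is `1`. -/
structure TandemQueue where
  /-- arrival rate at node 1 -/
  lam : ℝ
  /-- node-1 resources are chosen from `[0, aMax]` -/
  aMax : ℝ
  /-- node-2 resources are chosen from `[0, bMax]` -/
  bMax : ℝ
  /-- service rate at node 1 as a function of the resources used -/
  mu1 : ℝ → ℝ
  /-- service rate at node 2 as a function of the resources used -/
  mu2 : ℝ → ℝ
  /-- resource cost rate at node 1 -/
  c1 : ℝ → ℝ
  /-- resource cost rate at node 2 -/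
  c2 : ℝ → ℝ
  /-- holding cost rate per customer at node 1 -/
  h1 : ℝ
  /-- holding cost rate per customer at node 2 -/
  h2 : ℝ
  lam_pos : 0 < lam
  aMax_nonneg : 0 ≤ aMax
  bMax_nonneg : 0 ≤ bMax
  mu1_zero : mu1 0 = 0
  mu2_zero : mu2 0 = 0
  mu1_strictMono : StrictMonoOn mu1 (Icc 0 aMax)
  mu2_strictMono : StrictMonoOn mu2 (Icc 0 bMax)
  c1_zero : c1 0 = 0
  c2_zero : c2 0 = 0
  c1_strictMono : StrictMonoOn c1 (Icc 0 aMax)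
  c2_strictMono : StrictMonoOn c2 (Icc 0 bMax)
  c1_continuous : ContinuousOn c1 (Icc 0 aMax)
  c2_continuous : ContinuousOn c2 (Icc 0 bMax)
  h1_nonneg : 0 ≤ h1
  h2_nonneg : 0 ≤ h2
  stable1 : lam < mu1 aMax
  stable2 : lam < mu2 bMax
  normalized : lam + mu1 aMax + mu2 bMax = 1

namespace TandemQueue

/-- The state `(x₁, x₂)`: the numbers of customers at nodes 1 and 2. -/
abbrev State : Type := ℕ × ℕ

/-- One more customer at node 1. -/
def e₁ : State := (1, 0)

/-- One more customer at node 2. -/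
def e₂ : State := (0, 1)

/-- The state `x - e₁ + e₂` after a service completion at node 1; if node 1 is empty there is no
such completion and the transition is a dummy one. -/
def serve1 : State → State
  | (0, x₂) => (0, x₂)
  | (x₁ + 1, x₂) => (x₁, x₂ + 1)

/-- The state `x - e₂` after a service completion at node 2; if node 2 is empty there is no
such completion and the transition is a dummy one. -/
def serve2 : State → State
  | (x₁, 0) => (x₁, 0)
  | (x₁, x₂ + 1) => (x₁, x₂)

/-- The expression minimized over `a ∈ [0, aMax]` in `T₁ v(x)`. -/
def cost1 (Q : TandemQueue) (v : State → ℝ) (x : State) (a : ℝ) : ℝ :=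
  Q.mu1 a * v (serve1 x) + (Q.mu1 Q.aMax - Q.mu1 a) * v x + Q.c1 a

/-- The expression minimized over `b ∈ [0, bMax]` in `T₂ v(x)`. -/
def cost2 (Q : TandemQueue) (v : State → ℝ) (x : State) (b : ℝ) : ℝ :=
  Q.mu2 b * v (serve2 x) + (Q.mu2 Q.bMax - Q.mu2 b) * v x + Q.c2 b

/-- The event operator `T₁` (the infimum runs over a nonempty set of reals bounded below, and is the
minimum whenever that is attained). -/
noncomputable def T1 (Q : TandemQueue) (v : State → ℝ) (x : State) : ℝ :=
  sInf (Q.cost1 v x '' Icc 0 Q.aMax)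

/-- The event operator `T₂`. -/
noncomputable def T2 (Q : TandemQueue) (v : State → ℝ) (x : State) : ℝ :=
  sInf (Q.cost2 v x '' Icc 0 Q.bMax)

/-- The set `arg T₁ v(x)` of optimal resource allocations to node 1 in state `x`. -/
def argT1 (Q : TandemQueue) (v : State → ℝ) (x : State) : Set ℝ :=
  {a | a ∈ Icc 0 Q.aMax ∧ IsMinOn (Q.cost1 v x) (Icc 0 Q.aMax) a}

/-- The set `arg T₂ v(x)` of optimal resource allocations to node 2 in state `x`. -/
def argT2 (Q : TandemQueue) (v : State → ℝ) (x : State) : Set ℝ :=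
  {b | b ∈ Icc 0 Q.bMax ∧ IsMinOn (Q.cost2 v x) (Icc 0 Q.bMax) b}

/-- The dynamic programming operator. -/
noncomputable def T (Q : TandemQueue) (v : State → ℝ) (x : State) : ℝ :=
  Q.lam * v (x + e₁) + (Q.T1 v x + Q.T2 v x) + (Q.h1 * (x.1 : ℝ) + Q.h2 * (x.2 : ℝ))

/-- Value iteration `v₀ = 0`, `vₙ₊₁ = T vₙ`: `Q.V n x` is the minimal expected total cost over `n`
steps when the system starts in `x`. -/
noncomputable def V (Q : TandemQueue) : ℕ → State → ℝ
  | 0 => fun _ => 0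
  | n + 1 => Q.T (Q.V n)

/-- `v` is a relative value function with optimal average cost `g`: it solves the optimality
equation `T v = v + g`, and `v x - v 0` is the asymptotic difference in minimal total costs that
results from starting in `x` instead of the reference state `0`. The second clause is needed to
single out `v` up to an additive constant, since the optimality equation alone also has spurious
solutions on the infinite state space. -/
structure IsRelativeValueFunction (Q : TandemQueue) (v : State → ℝ) (g : ℝ) : Prop where
  optimality : ∀ x, Q.T v x = v x + g
  asymptotic : ∀ x, Tendsto (fun n => Q.V n x - Q.V n 0) atTop (𝓝 (v x - v 0))

end TandemQueue

/-! Minimizing at a node amounts to maximizing `mu a * d - c a`, where `d` is the drop in `v` caused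
by a completion. Larger `d` favours larger allocations, so the claim is a convexity property of `v`:
`d` must grow with the node's own queue.

The weak property is multimodularity. It holds for the zero function and survives `T`
(`Multimodular.T1`, `Multimodular.T2`). The gain `serviceGain` is convex and monotone with slope at
most the maximal rate, which is exactly what this requires. The limit defining `v` inherits it.

Weak convexity does not exclude ties: for equal `d` the minimizer need not be unique, and any
minimizers may be compared. By `minimizers_lt`, a violation forces `d` not to increase and to be
positive. If the node's holding cost is positive, `mm1_ne_zero` and `mm2_mm3_ne_zero` give strict
growth of `d`: a vanishing second difference would make every nonnegative term in its recursion
vanish, and the optimality equation then contradicts the holding cost. If it is zero, a completion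
there saves nothing, so `d` is not positive. -/

namespace TandemQueue

/-! ### Service gains and comparison of minimizers -/

/-- The largest net gain `μ(a) d - c(a)` over `a ∈ [0, A]` when a service completion is worth `d`. -/
noncomputable def serviceGain (mu c : ℝ → ℝ) (A d : ℝ) : ℝ :=
  sSup ((fun a => mu a * d - c a) '' Icc 0 A)

/-- The properties of `serviceGain` that the propagation of multimodularity depends on. -/
structure IsGain (M : ℝ) (φ : ℝ → ℝ) : Prop where
  zero : φ 0 = 0
  nonneg : ∀ d, 0 ≤ φ d
  mono : Monotone φ
  lip : ∀ d d', d ≤ d' → φ d' ≤ φ d + M * (d' - d)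
  convex : ConvexOn ℝ univ φ

section Gain

variable {mu c : ℝ → ℝ} {A : ℝ}

theorem mu_mem (hA : 0 ≤ A) (mu0 : mu 0 = 0) (hmu : StrictMonoOn mu (Icc 0 A)) {a : ℝ}
    (ha : a ∈ Icc 0 A) : 0 ≤ mu a ∧ mu a ≤ mu A := by
  constructor
  · rw [← mu0]
    exact hmu.monotoneOn ⟨le_rfl, hA⟩ ha ha.1
  · exact hmu.monotoneOn ha ⟨hA, le_rfl⟩ ha.2

theorem isLUB_serviceGain (hA : 0 ≤ A) (mu0 : mu 0 = 0) (hmu : StrictMonoOn mu (Icc 0 A))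
    (c0 : c 0 = 0) (hc : StrictMonoOn c (Icc 0 A)) (d : ℝ) :
    IsLUB ((fun a => mu a * d - c a) '' Icc 0 A) (serviceGain mu c A d) := by
  refine isLUB_csSup ⟨_, 0, ⟨le_rfl, hA⟩, rfl⟩ ⟨mu A * |d|, ?_⟩
  rintro _ ⟨a, ha, rfl⟩
  have h1 := mu_mem hA mu0 hmu ha
  have h2 := (mu_mem hA c0 hc ha).1
  have h3 : mu a * d ≤ mu a * |d| := mul_le_mul_of_nonneg_left (le_abs_self d) h1.1
  have h4 : mu a * |d| ≤ mu A * |d| := mul_le_mul_of_nonneg_right h1.2 (abs_nonneg d)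
  change mu a * d - c a ≤ mu A * |d|
  linarith

theorem isGain_serviceGain (hA : 0 ≤ A) (mu0 : mu 0 = 0) (hmu : StrictMonoOn mu (Icc 0 A))
    (c0 : c 0 = 0) (hc : StrictMonoOn c (Icc 0 A)) :
    IsGain (mu A) (serviceGain mu c A) := by
  have lub := isLUB_serviceGain hA mu0 hmu c0 hc
  have le_gain : ∀ d, ∀ a ∈ Icc 0 A, mu a * d - c a ≤ serviceGain mu c A d :=
    fun d a ha => (lub d).1 ⟨a, ha, rfl⟩
  have gain_le : ∀ d B, (∀ a ∈ Icc 0 A, mu a * d - c a ≤ B) → serviceGain mu c A d ≤ B := by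
    intro d B h
    refine (lub d).2 ?_
    rintro _ ⟨a, ha, rfl⟩
    exact h a ha
  have nonneg : ∀ d, 0 ≤ serviceGain mu c A d := by
    intro d
    have := le_gain d 0 ⟨le_rfl, hA⟩
    rw [mu0, c0] at this
    linarith
  refine ⟨le_antisymm (gain_le _ _ fun a ha => ?_) (nonneg 0), nonneg, ?_, ?_, convex_univ, ?_⟩
  · have := (mu_mem hA c0 hc ha).1
    linarith
  · intro d d' hd
    refine gain_le _ _ fun a ha => ?_
    have h1 := le_gain d' a ha
    have h2 := mul_le_mul_of_nonneg_left hd (mu_mem hA mu0 hmu ha).1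
    linarith
  · intro d d' hd
    refine gain_le _ _ fun a ha => ?_
    have h1 := le_gain d a ha
    have h2 := mul_le_mul_of_nonneg_right (mu_mem hA mu0 hmu ha).2 (sub_nonneg.2 hd)
    linarith
  · intro d _ d' _ s t hs ht hst
    simp only [smul_eq_mul]
    refine gain_le _ _ fun a ha => ?_
    have h1 := mul_le_mul_of_nonneg_left (le_gain d a ha) hs
    have h2 := mul_le_mul_of_nonneg_left (le_gain d' a ha) ht
    have h3 : mu a * (s * d + t * d') - c a
        = s * (mu a * d - c a) + t * (mu a * d' - c a) := by
      linear_combination c a * hst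
    linarith

theorem sInf_cost (hA : 0 ≤ A) (mu0 : mu 0 = 0) (hmu : StrictMonoOn mu (Icc 0 A))
    (c0 : c 0 = 0) (hc : StrictMonoOn c (Icc 0 A)) (p q : ℝ) :
    sInf ((fun a => mu a * p + (mu A - mu a) * q + c a) '' Icc 0 A)
      = mu A * q - serviceGain mu c A (q - p) := by
  have lub := isLUB_serviceGain hA mu0 hmu c0 hc (q - p)
  refine IsGLB.csInf_eq ⟨?_, fun L hL => ?_⟩ ⟨_, 0, ⟨le_rfl, hA⟩, rfl⟩
  · rintro _ ⟨a, ha, rfl⟩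
    have := lub.1 ⟨a, ha, rfl⟩
    simp only at this ⊢
    linarith
  · have : serviceGain mu c A (q - p) ≤ mu A * q - L := by
      refine lub.2 ?_
      rintro _ ⟨a, ha, rfl⟩
      have := hL ⟨a, ha, rfl⟩
      simp only at this ⊢
      linarith
    linarith

/-- If a minimizer `a₁` for the completion value `q' - p'` lies below a minimizer `a₂` for
`q - p`, then `q' - p' ≤ q - p` and `q - p` is positive. -/
theorem minimizers_lt (hmu : StrictMonoOn mu (Icc 0 A)) (hc : StrictMonoOn c (Icc 0 A))
    {p q p' q' a₁ a₂ : ℝ} (h₁ : a₁ ∈ Icc 0 A) (h₂ : a₂ ∈ Icc 0 A)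
    (m₁ : IsMinOn (fun a => mu a * p' + (mu A - mu a) * q' + c a) (Icc 0 A) a₁)
    (m₂ : IsMinOn (fun a => mu a * p + (mu A - mu a) * q + c a) (Icc 0 A) a₂) (h : a₁ < a₂) :
    q' - p' ≤ q - p ∧ 0 < q - p := by
  have hm := sub_pos.2 (hmu h₁ h₂ h)
  have hcc := hc h₁ h₂ h
  have e₁ := isMinOn_iff.1 m₁ _ h₂
  have e₂ := isMinOn_iff.1 m₂ _ h₁
  constructor
  -- Adding the two minimality inequalities cancels the resource costs.
  · refine le_of_mul_le_mul_left ?_ hm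
    linarith
  -- Minimality of `a₂` alone suffices: its strictly higher cost must be repaid.
  · refine pos_of_mul_pos_right (a := mu a₂ - mu a₁) ?_ hm.le
    linarith

end Gain

namespace IsGain

variable {M : ℝ} {φ : ℝ → ℝ}

theorem eq_zero_of_nonpos (hφ : IsGain M φ) {d : ℝ} (hd : d ≤ 0) : φ d = 0 :=
  le_antisymm (hφ.zero ▸ hφ.mono hd) (hφ.nonneg d)

theorem increments (hφ : IsGain M φ) {a b s : ℝ} (hab : a ≤ b) (hs : 0 ≤ s) :
    φ (a + s) + φ b ≤ φ a + φ (b + s) := by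
  rcases hab.eq_or_lt with rfl | hab
  · linarith
  have hL : 0 < b + s - a := by linarith
  have hL' := hL.ne'
  -- `a + s` and `b` are convex combinations of `a` and `b + s` with swapped weights.
  have w₁ : 0 ≤ (b - a) / (b + s - a) := div_nonneg (by linarith) hL.le
  have w₂ : 0 ≤ s / (b + s - a) := div_nonneg hs hL.le
  have w : (b - a) / (b + s - a) + s / (b + s - a) = 1 := by field_simp; ring
  have k₁ := hφ.convex.2 (mem_univ a) (mem_univ (b + s)) w₁ w₂ w
  have k₂ := hφ.convex.2 (mem_univ a) (mem_univ (b + s)) w₂ w₁ (by rw [add_comm]; exact w)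
  simp only [smul_eq_mul] at k₁ k₂
  have p₁ : (b - a) / (b + s - a) * a + s / (b + s - a) * (b + s) = a + s := by
    field_simp; ring
  have p₂ : s / (b + s - a) * a + (b - a) / (b + s - a) * (b + s) = b := by
    field_simp; ring
  rw [p₁] at k₁
  rw [p₂] at k₂
  have : ((b - a) / (b + s - a) + s / (b + s - a)) * (φ a + φ (b + s)) = φ a + φ (b + s) := by
    rw [w, one_mul]
  linarith

/-- Convexity spreads `a`, `b` to `d`, `a + b - d`, and the slope bound pays for the excess `r`. In
use, `r` is a second difference of `v` and `M * r` its uniformization term. -/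
theorem add_le_add (hφ : IsGain M φ) {a b c d r : ℝ} (hda : d ≤ a) (hdb : d ≤ b) (hr : 0 ≤ r)
    (h : a + b ≤ c + d + r) : φ a + φ b ≤ φ c + φ d + M * r := by
  have h₁ := hφ.increments hda (sub_nonneg.2 hdb)
  rw [add_sub_cancel] at h₁
  have h₂ : φ (a + (b - d)) ≤ φ (c + r) := hφ.mono (by linarith)
  have h₃ := hφ.lip c (c + r) (by linarith)
  rw [add_sub_cancel_left] at h₃
  linarith

/-- Convexity makes the slopes to the left of a flat piece nonpositive, and `φ` vanishes on the
negative half-line. -/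
theorem eq_zero_of_flat (hφ : IsGain M φ) {a b : ℝ} (hab : a < b) (h : φ b ≤ φ a) :
    φ b = 0 := by
  refine le_antisymm ?_ (hφ.nonneg b)
  have hx : min a 0 - 1 < a := by linarith [min_le_left a 0]
  have hx' : φ (min a 0 - 1) = 0 := hφ.eq_zero_of_nonpos (by linarith [min_le_right a 0])
  have hs := hφ.convex.slope_mono_adjacent (mem_univ _) (mem_univ _) hx hab
  have hn : (φ b - φ a) / (b - a) ≤ 0 :=
    div_nonpos_of_nonpos_of_nonneg (by linarith) (by linarith)
  have hp : (φ a - φ (min a 0 - 1)) / (a - (min a 0 - 1)) * (a - (min a 0 - 1))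
      = φ a - φ (min a 0 - 1) := div_mul_cancel₀ _ (by linarith)
  have := mul_nonpos_of_nonpos_of_nonneg (hs.trans hn) (sub_nonneg.2 hx.le)
  linarith

end IsGain

/-! ### Multimodularity and its propagation -/

/-- The second difference of `v` in the directions `e₁` and `e₂ - e₁`. -/
def mm1 (v : State → ℝ) (i j : ℕ) : ℝ :=
  v (i + 2, j) + v (i, j + 1) - v (i + 1, j) - v (i + 1, j + 1)

/-- The second difference of `v` in the directions `e₁` and `-e₂`. -/
def mm2 (v : State → ℝ) (i j : ℕ) : ℝ :=
  v (i + 1, j + 1) + v (i, j) - v (i + 1, j) - v (i, j + 1)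

/-- The second difference of `v` in the directions `e₂ - e₁` and `-e₂`. -/
def mm3 (v : State → ℝ) (i j : ℕ) : ℝ :=
  v (i, j + 2) + v (i + 1, j) - v (i + 1, j + 1) - v (i, j + 1)

/-- Multimodularity with respect to the directions `e₁`, `e₂ - e₁`, `-e₂`. -/
structure Multimodular (v : State → ℝ) : Prop where
  mm1 : ∀ i j, 0 ≤ mm1 v i j
  mm2 : ∀ i j, 0 ≤ mm2 v i j
  mm3 : ∀ i j, 0 ≤ mm3 v i j

variable (Q : TandemQueue)

/-- The net gain from service at node 1. -/
noncomputable def gain1 : ℝ → ℝ := serviceGain Q.mu1 Q.c1 Q.aMax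

/-- The net gain from service at node 2. -/
noncomputable def gain2 : ℝ → ℝ := serviceGain Q.mu2 Q.c2 Q.bMax

theorem isGain1 : IsGain (Q.mu1 Q.aMax) Q.gain1 :=
  isGain_serviceGain Q.aMax_nonneg Q.mu1_zero Q.mu1_strictMono Q.c1_zero Q.c1_strictMono

theorem isGain2 : IsGain (Q.mu2 Q.bMax) Q.gain2 :=
  isGain_serviceGain Q.bMax_nonneg Q.mu2_zero Q.mu2_strictMono Q.c2_zero Q.c2_strictMono

theorem mu1_max_nonneg : 0 ≤ Q.mu1 Q.aMax := Q.lam_pos.le.trans Q.stable1.le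

theorem mu2_max_nonneg : 0 ≤ Q.mu2 Q.bMax := Q.lam_pos.le.trans Q.stable2.le

theorem T1_zero (v : State → ℝ) (j : ℕ) : Q.T1 v (0, j) = Q.mu1 Q.aMax * v (0, j) := by
  have := sInf_cost Q.aMax_nonneg Q.mu1_zero Q.mu1_strictMono Q.c1_zero Q.c1_strictMono
    (v (0, j)) (v (0, j))
  rw [sub_self] at this
  refine this.trans ?_
  change _ - Q.gain1 0 = _
  rw [Q.isGain1.zero, sub_zero]

theorem T1_succ (v : State → ℝ) (i j : ℕ) : Q.T1 v (i + 1, j)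
    = Q.mu1 Q.aMax * v (i + 1, j) - Q.gain1 (v (i + 1, j) - v (i, j + 1)) :=
  sInf_cost Q.aMax_nonneg Q.mu1_zero Q.mu1_strictMono Q.c1_zero Q.c1_strictMono
    (v (i, j + 1)) (v (i + 1, j))

theorem T2_zero (v : State → ℝ) (i : ℕ) : Q.T2 v (i, 0) = Q.mu2 Q.bMax * v (i, 0) := by
  have := sInf_cost Q.bMax_nonneg Q.mu2_zero Q.mu2_strictMono Q.c2_zero Q.c2_strictMono
    (v (i, 0)) (v (i, 0))
  rw [sub_self] at this
  refine this.trans ?_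
  change _ - Q.gain2 0 = _
  rw [Q.isGain2.zero, sub_zero]

theorem T2_succ (v : State → ℝ) (i j : ℕ) : Q.T2 v (i, j + 1)
    = Q.mu2 Q.bMax * v (i, j + 1) - Q.gain2 (v (i, j + 1) - v (i, j)) :=
  sInf_cost Q.bMax_nonneg Q.mu2_zero Q.mu2_strictMono Q.c2_zero Q.c2_strictMono
    (v (i, j)) (v (i, j + 1))

theorem T_apply (v : State → ℝ) (i j : ℕ) : Q.T v (i, j) = Q.lam * v (i + 1, j)
    + (Q.T1 v (i, j) + Q.T2 v (i, j)) + (Q.h1 * (i : ℝ) + Q.h2 * (j : ℝ)) := rfl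

theorem mm1_T (v : State → ℝ) (i j : ℕ) : mm1 (Q.T v) i j
    = Q.lam * mm1 v (i + 1) j + mm1 (Q.T1 v) i j + mm1 (Q.T2 v) i j := by
  simp only [mm1, T_apply]
  push_cast
  ring

theorem mm2_T (v : State → ℝ) (i j : ℕ) : mm2 (Q.T v) i j
    = Q.lam * mm2 v (i + 1) j + mm2 (Q.T1 v) i j + mm2 (Q.T2 v) i j := by
  simp only [mm2, T_apply]
  push_cast
  ring

theorem mm3_T (v : State → ℝ) (i j : ℕ) : mm3 (Q.T v) i j
    = Q.lam * mm3 v (i + 1) j + mm3 (Q.T1 v) i j + mm3 (Q.T2 v) i j := by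
  simp only [mm3, T_apply]
  push_cast
  ring

variable {Q}
variable {v : State → ℝ} {g : ℝ}

/-- The slope bound lets the uniformization term absorb a gain difference of the wrong sign;
monotonicity handles the rest. Only the interior `mm2` case couples all four gains and needs
`add_le_add`. At `i = 0` the dummy transition has no gain. -/
theorem Multimodular.T1 (hm : Multimodular v) : Multimodular (Q.T1 v) := by
  have hφ := Q.isGain1
  refine ⟨fun i j => ?_, fun i j => ?_, fun i j => ?_⟩
  · have a₁ := hm.mm1 i j
    have k₁ := hφ.lip (v (i + 1, j) - v (i, j + 1)) (v (i + 2, j) - v (i + 1, j + 1))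
      (by unfold TandemQueue.mm1 at a₁; linarith)
    cases i with
    | zero =>
      have k₂ := hφ.nonneg (v (1, j + 1) - v (0, j + 2))
      simp only [TandemQueue.mm1, T1_zero, T1_succ, zero_add] at *
      linarith
    | succ i =>
      have a₂ := hm.mm1 i (j + 1)
      have k₂ := hφ.mono (a := v (i + 1, j + 1) - v (i, j + 2))
        (b := v (i + 2, j + 1) - v (i + 1, j + 2)) (by unfold TandemQueue.mm1 at a₂; linarith)
      simp only [TandemQueue.mm1, T1_succ, add_assoc, Nat.reduceAdd] at *
      linarith
  · have a₁ := hm.mm2 i j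
    cases i with
    | zero =>
      have a₂ := hm.mm3 0 j
      have k₂ := hφ.mono (a := v (1, j + 1) - v (0, j + 2))
        (b := v (1, j) - v (0, j + 1)) (by unfold TandemQueue.mm3 at a₂; linarith)
      have k₃ := mul_nonneg Q.mu1_max_nonneg a₁
      simp only [TandemQueue.mm2, T1_zero, T1_succ, zero_add] at *
      linarith
    | succ i =>
      have a₂ := hm.mm1 i (j + 1)
      have a₃ := hm.mm3 i j
      have a₄ := hm.mm2 i (j + 1)
      have k := hφ.add_le_add (a := v (i + 2, j + 1) - v (i + 1, j + 2))
        (b := v (i + 1, j) - v (i, j + 1)) (c := v (i + 2, j) - v (i + 1, j + 1))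
        (d := v (i + 1, j + 1) - v (i, j + 2))
        (by unfold TandemQueue.mm1 at a₂; linarith)
        (by unfold TandemQueue.mm3 at a₃; linarith) a₁
        (by unfold TandemQueue.mm2 at a₄ ⊢; linarith)
      simp only [TandemQueue.mm2, T1_succ, add_assoc, Nat.reduceAdd] at *
      linarith
  · have a₁ := hm.mm3 i j
    have k₁ := hφ.lip (v (i + 1, j + 1) - v (i, j + 2)) (v (i + 1, j) - v (i, j + 1))
      (by unfold TandemQueue.mm3 at a₁; linarith)
    cases i with
    | zero =>
      simp only [TandemQueue.mm3, T1_zero, T1_succ, zero_add] at *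
      linarith
    | succ i =>
      have a₂ := hm.mm3 i (j + 1)
      have k₂ := hφ.mono (a := v (i + 1, j + 2) - v (i, j + 3))
        (b := v (i + 1, j + 1) - v (i, j + 2)) (by unfold TandemQueue.mm3 at a₂; linarith)
      simp only [TandemQueue.mm3, T1_succ, add_assoc, Nat.reduceAdd] at *
      linarith

theorem Multimodular.T2 (hm : Multimodular v) : Multimodular (Q.T2 v) := by
  have hφ := Q.isGain2
  refine ⟨fun i j => ?_, fun i j => ?_, fun i j => ?_⟩
  · have a₁ := hm.mm1 i j
    have a₂ := hm.mm2 i j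
    cases j with
    | zero =>
      have k₂ := hφ.mono (a := v (i, 1) - v (i, 0)) (b := v (i + 1, 1) - v (i + 1, 0))
        (by unfold TandemQueue.mm2 at a₂; linarith)
      have k₃ := mul_nonneg Q.mu2_max_nonneg a₁
      simp only [TandemQueue.mm1, T2_zero, T2_succ, zero_add] at *
      linarith
    | succ j =>
      have a₃ := hm.mm1 i j
      have a₄ := hm.mm2 (i + 1) j
      have a₅ := hm.mm3 i j
      have k := hφ.add_le_add (a := v (i + 2, j + 1) - v (i + 2, j))
        (b := v (i, j + 2) - v (i, j + 1)) (c := v (i + 1, j + 2) - v (i + 1, j + 1))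
        (d := v (i + 1, j + 1) - v (i + 1, j))
        (by unfold TandemQueue.mm2 at a₄; linarith)
        (by unfold TandemQueue.mm3 at a₅; linarith) a₁
        (by unfold TandemQueue.mm1 at a₃ ⊢; linarith)
      simp only [TandemQueue.mm1, T2_succ, add_assoc, Nat.reduceAdd] at *
      linarith
  · have a₁ := hm.mm2 i j
    have k₁ := hφ.lip (v (i, j + 1) - v (i, j)) (v (i + 1, j + 1) - v (i + 1, j))
      (by unfold TandemQueue.mm2 at a₁; linarith)
    cases j with
    | zero =>
      simp only [TandemQueue.mm2, T2_zero, T2_succ, zero_add] at *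
      linarith
    | succ j =>
      have a₂ := hm.mm2 i j
      have k₂ := hφ.mono (a := v (i, j + 1) - v (i, j))
        (b := v (i + 1, j + 1) - v (i + 1, j)) (by unfold TandemQueue.mm2 at a₂; linarith)
      simp only [TandemQueue.mm2, T2_succ, add_assoc, Nat.reduceAdd] at *
      linarith
  · have a₁ := hm.mm3 i j
    have k₁ := hφ.lip (v (i + 1, j + 1) - v (i + 1, j)) (v (i, j + 2) - v (i, j + 1))
      (by unfold TandemQueue.mm3 at a₁; linarith)
    cases j with
    | zero =>
      have k₂ := hφ.nonneg (v (i, 1) - v (i, 0))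
      simp only [TandemQueue.mm3, T2_zero, T2_succ, zero_add] at *
      linarith
    | succ j =>
      have a₂ := hm.mm3 i j
      have k₂ := hφ.mono (a := v (i + 1, j + 1) - v (i + 1, j))
        (b := v (i, j + 2) - v (i, j + 1)) (by unfold TandemQueue.mm3 at a₂; linarith)
      simp only [TandemQueue.mm3, T2_succ, add_assoc, Nat.reduceAdd] at *
      linarith

theorem Multimodular.T (hm : Multimodular v) : Multimodular (Q.T v) := by
  refine ⟨fun i j => ?_, fun i j => ?_, fun i j => ?_⟩
  · rw [mm1_T]
    exact add_nonneg (add_nonneg (mul_nonneg Q.lam_pos.le (hm.mm1 _ _)) (hm.T1.mm1 _ _))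
      (hm.T2.mm1 _ _)
  · rw [mm2_T]
    exact add_nonneg (add_nonneg (mul_nonneg Q.lam_pos.le (hm.mm2 _ _)) (hm.T1.mm2 _ _))
      (hm.T2.mm2 _ _)
  · rw [mm3_T]
    exact add_nonneg (add_nonneg (mul_nonneg Q.lam_pos.le (hm.mm3 _ _)) (hm.T1.mm3 _ _))
      (hm.T2.mm3 _ _)

variable (Q) in
theorem multimodular_V (n : ℕ) : Multimodular (Q.V n) := by
  induction n with
  | zero => constructor <;> intro i j <;> simp [V, mm1, mm2, mm3]
  | succ n ih => exact ih.T

/-! ### Multimodularity of the relative value function and its strictness -/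

namespace IsRelativeValueFunction

theorem multimodular (hv : Q.IsRelativeValueFunction v g) : Multimodular v := by
  have ht := hv.asymptotic
  refine ⟨fun i j => ?_, fun i j => ?_, fun i j => ?_⟩
  · have := ge_of_tendsto' ((((ht (i + 2, j)).add (ht (i, j + 1))).sub (ht (i + 1, j))).sub
      (ht (i + 1, j + 1))) (b := 0) fun n => by
        have := (multimodular_V Q n).mm1 i j
        unfold mm1 at this
        linarith
    unfold mm1
    linarith
  · have := ge_of_tendsto' ((((ht (i + 1, j + 1)).add (ht (i, j))).sub (ht (i + 1, j))).sub
      (ht (i, j + 1))) (b := 0) fun n => by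
        have := (multimodular_V Q n).mm2 i j
        unfold mm2 at this
        linarith
    unfold mm2
    linarith
  · have := ge_of_tendsto' ((((ht (i, j + 2)).add (ht (i + 1, j))).sub (ht (i + 1, j + 1))).sub
      (ht (i, j + 1))) (b := 0) fun n => by
        have := (multimodular_V Q n).mm3 i j
        unfold mm3 at this
        linarith
    unfold mm3
    linarith

theorem le_of_V_le (hv : Q.IsRelativeValueFunction v g) {x y : State}
    (h : ∀ n, Q.V n x ≤ Q.V n y) : v x ≤ v y := by
  have := le_of_tendsto_of_tendsto' (hv.asymptotic x) (hv.asymptotic y)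
    fun n => sub_le_sub_right (h n) _
  linarith

theorem optimality_at (hv : Q.IsRelativeValueFunction v g) (i j : ℕ) :
    Q.lam * v (i + 1, j) + (Q.T1 v (i, j) + Q.T2 v (i, j)) + (Q.h1 * (i : ℝ) + Q.h2 * (j : ℝ))
      = v (i, j) + g := by
  rw [← T_apply]
  exact hv.optimality _

/-- `T v` and `v` differ by a constant, so a zero second difference is a sum of three nonnegative
terms, each of which must vanish. -/
theorem mm1_eq_zero (hv : Q.IsRelativeValueFunction v g) {i j : ℕ} (h : mm1 v i j = 0) :
    mm1 v (i + 1) j = 0 ∧ mm1 (Q.T2 v) i j = 0 := by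
  have hm := hv.multimodular
  have e := mm1_T Q v i j
  have e' : mm1 (Q.T v) i j = mm1 v i j := by
    simp only [mm1, hv.optimality]
    ring
  have k₁ := mul_nonneg Q.lam_pos.le (hm.mm1 (i + 1) j)
  have k₂ := (hm.T1 (Q := Q)).mm1 i j
  have k₃ := (hm.T2 (Q := Q)).mm1 i j
  refine ⟨?_, by linarith⟩
  have : Q.lam * mm1 v (i + 1) j = 0 := by linarith
  exact (mul_eq_zero.1 this).resolve_left Q.lam_pos.ne'

theorem mm2_eq_zero (hv : Q.IsRelativeValueFunction v g) {i j : ℕ} (h : mm2 v i j = 0) :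
    mm2 v (i + 1) j = 0 := by
  have hm := hv.multimodular
  have e := mm2_T Q v i j
  have e' : mm2 (Q.T v) i j = mm2 v i j := by
    simp only [mm2, hv.optimality]
    ring
  have k₁ := mul_nonneg Q.lam_pos.le (hm.mm2 (i + 1) j)
  have k₂ := (hm.T1 (Q := Q)).mm2 i j
  have k₃ := (hm.T2 (Q := Q)).mm2 i j
  have : Q.lam * mm2 v (i + 1) j = 0 := by linarith
  exact (mul_eq_zero.1 this).resolve_left Q.lam_pos.ne'

theorem mm3_eq_zero (hv : Q.IsRelativeValueFunction v g) {i j : ℕ} (h : mm3 v i j = 0) :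
    mm3 v (i + 1) j = 0 ∧ mm3 (Q.T2 v) i j = 0 := by
  have hm := hv.multimodular
  have e := mm3_T Q v i j
  have e' : mm3 (Q.T v) i j = mm3 v i j := by
    simp only [mm3, hv.optimality]
    ring
  have k₁ := mul_nonneg Q.lam_pos.le (hm.mm3 (i + 1) j)
  have k₂ := (hm.T1 (Q := Q)).mm3 i j
  have k₃ := (hm.T2 (Q := Q)).mm3 i j
  refine ⟨?_, by linarith⟩
  have : Q.lam * mm3 v (i + 1) j = 0 := by linarith
  exact (mul_eq_zero.1 this).resolve_left Q.lam_pos.ne'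

/-- With a positive holding cost at node 1, the first multimodularity inequality is strict. -/
theorem mm1_ne_zero (hv : Q.IsRelativeValueFunction v g) (hh : 0 < Q.h1) (j : ℕ) :
    ∀ i, mm1 v i j ≠ 0 := by
  have hm := hv.multimodular
  have hφ := Q.isGain2
  induction j with
  | zero =>
    intro i h
    have a₁ := (hv.mm1_eq_zero h).1
    have a₂ := mul_nonneg Q.lam_pos.le (hm.mm2 (i + 1) 0)
    have o₁ := hv.optimality_at (i + 1) 0
    have o₂ := hv.optimality_at (i + 2) 0
    rw [T1_succ, T2_zero] at o₁ o₂
    -- Equal completion values cancel the node-1 gains when the optimality equations are subtracted.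
    -- What remains is `lam` times a second difference in `x₁`, plus `h1`, equal to zero; but that
    -- difference is `mm1 + mm2` at `(i + 1, 0)`, hence nonnegative.
    have d₁ : v (i + 1 + 1, 0) - v (i + 1, 0 + 1) = v (i + 1, 0) - v (i, 0 + 1) := by
      unfold mm1 at h; linarith
    have n := Q.normalized
    rw [d₁] at o₂
    have k : Q.lam * mm1 v (i + 1) 0 = 0 := by rw [a₁, mul_zero]
    simp only [mm1, mm2] at *
    push_cast at *
    have n₁ := congrArg (· * v (i + 1, 0)) n
    have n₂ := congrArg (· * v (i + 2, 0)) n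
    simp only [add_assoc, Nat.reduceAdd] at *
    linarith
  | succ j ih =>
    intro i h
    have b₁ := hv.mm1_eq_zero h
    -- Strictness one level down makes `gain2` constant over an interval of positive length, so it
    -- is zero there.
    have flat : ∀ i, mm1 v i (j + 1) = 0 →
        Q.gain2 (v (i + 1, j + 2) - v (i + 1, j + 1)) = 0 := by
      intro i h
      have b := (hv.mm1_eq_zero h).2
      have q : 0 < mm1 v i j := lt_of_le_of_ne (hm.mm1 i j) (ih i).symm
      have a := hm.mm2 (i + 1) j
      have a' := hm.mm3 i j
      have k := hφ.increments (a := v (i + 1, j + 1) - v (i + 1, j))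
        (b := v (i, j + 2) - v (i, j + 1))
        (s := (v (i + 2, j + 1) - v (i + 2, j)) - (v (i + 1, j + 1) - v (i + 1, j)))
        (by unfold mm3 at a'; linarith) (by unfold mm2 at a; linarith)
      rw [add_sub_cancel] at k
      refine hφ.eq_zero_of_flat (a := v (i, j + 2) - v (i, j + 1)
        + ((v (i + 2, j + 1) - v (i + 2, j)) - (v (i + 1, j + 1) - v (i + 1, j)))) ?_ ?_
      · simp only [mm1, add_assoc, Nat.reduceAdd] at *
        linarith
      · have r : Q.mu2 Q.bMax * mm1 v i (j + 1) = 0 := by rw [h, mul_zero]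
        simp only [mm1, T2_succ, add_assoc, Nat.reduceAdd] at *
        linarith
    have zero : ∀ i, mm1 v i (j + 1) = 0 →
        Q.gain2 (v (i + 2, j + 1) - v (i + 2, j)) = 0 := by
      intro i h
      have a := hm.mm3 (i + 1) j
      refine le_antisymm ?_ (hφ.nonneg _)
      rw [← flat i h]
      exact hφ.mono (by unfold mm3 at a; linarith)
    -- Node 2 now contributes only linear terms at both states, so the argument for `j = 0` applies.
    have z₁ := zero i h
    have z₂ := zero (i + 1) b₁.1
    have b₂ := hv.mm1_eq_zero b₁.1
    have a₂ := mul_nonneg Q.lam_pos.le (hm.mm2 (i + 2) (j + 1))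
    have o₁ := hv.optimality_at (i + 2) (j + 1)
    have o₂ := hv.optimality_at (i + 3) (j + 1)
    rw [T1_succ, T2_succ] at o₁ o₂
    have d₁ : v (i + 2 + 1, j + 1) - v (i + 2, j + 1 + 1)
        = v (i + 1 + 1, j + 1) - v (i + 1, j + 1 + 1) := by
      have := b₁.1
      unfold mm1 at this
      linarith
    have n := Q.normalized
    rw [d₁] at o₂
    have k : Q.lam * mm1 v (i + 2) (j + 1) = 0 := by rw [b₂.1, mul_zero]
    have n₁ := congrArg (· * v (i + 2, j + 1)) n
    have n₂ := congrArg (· * v (i + 3, j + 1)) n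
    clear b₁ b₂ flat zero h ih d₁
    simp only [mm1, mm2] at *
    push_cast at *
    simp only [add_assoc, Nat.reduceAdd] at *
    linarith

/-- With a positive holding cost at node 2, `v` is strictly convex in the second coordinate. -/
theorem mm2_mm3_ne_zero (hv : Q.IsRelativeValueFunction v g) (hh : 0 < Q.h2) (j : ℕ) :
    ∀ i, mm2 v i j = 0 → mm3 v i j ≠ 0 := by
  have hm := hv.multimodular
  have hφ := Q.isGain2
  -- If service at node 2 gained nothing, subtracting the optimality equations at `(i + 1, j)` and
  -- `(i + 1, j + 1)` would leave `h2` plus a nonnegative difference of node-1 gains equal to zero.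
  have key : ∀ i j, mm2 v i j = 0 → mm3 v i j = 0 →
      Q.gain2 (v (i + 1, j + 1) - v (i + 1, j)) ≠ 0 := by
    intro i j h₂ h₃ hz
    have h₂' := hv.mm2_eq_zero h₂
    have h₃' := (hv.mm3_eq_zero h₃).1
    have hz' : Q.gain2 (v (i + 1, j + 2) - v (i + 1, j + 1)) = 0 := by
      rw [← hz]
      congr 1
      unfold mm2 at h₂'
      unfold mm3 at h₃'
      linarith
    have t : Q.T2 v (i + 1, j) = Q.mu2 Q.bMax * v (i + 1, j) := by
      cases j with
      | zero => rw [T2_zero]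
      | succ j =>
        rw [T2_succ, sub_eq_self]
        refine le_antisymm ?_ (hφ.nonneg _)
        rw [← hz]
        have a₂ := hm.mm2 (i + 1) j
        have a₃ := hm.mm3 (i + 1) j
        refine hφ.mono ?_
        unfold mm2 at a₂
        unfold mm3 at a₃
        linarith
    have o₁ := hv.optimality_at (i + 1) j
    have o₂ := hv.optimality_at (i + 1) (j + 1)
    rw [t, T1_succ] at o₁
    rw [T1_succ, T2_succ, hz] at o₂
    have a := hm.mm3 i j
    have m := Q.isGain1.mono (a := v (i + 1, j + 1) - v (i, j + 1 + 1))
      (b := v (i + 1, j) - v (i, j + 1)) (by unfold mm3 at a; linarith)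
    have n₁ := congrArg (· * v (i + 1, j)) Q.normalized
    have n₂ := congrArg (· * v (i + 1, j + 1)) Q.normalized
    have k : Q.lam * mm2 v (i + 1) j = 0 := by rw [h₂', mul_zero]
    unfold mm2 at k
    push_cast at *
    linarith
  induction j with
  | zero =>
    intro i h₂ h₃
    refine key i 0 h₂ h₃ ?_
    have b := (hv.mm3_eq_zero h₃).2
    have e₁ : v (i, 2) - v (i, 1) = v (i + 1, 1) - v (i + 1, 0) := by
      simp only [mm3, zero_add] at h₃
      linarith
    have e₂ : v (i, 1) - v (i, 0) = v (i + 1, 1) - v (i + 1, 0) := by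
      simp only [mm2, zero_add] at h₂
      linarith
    have r : Q.mu2 Q.bMax * mm3 v i 0 = 0 := by rw [h₃, mul_zero]
    simp only [mm3, T2_zero, T2_succ, zero_add, Nat.reduceAdd] at b r ⊢
    rw [e₁, e₂] at b
    linarith
  | succ j ih =>
    intro i h₂ h₃
    have b := (hv.mm3_eq_zero h₃).2
    have e₁ : v (i, j + 3) - v (i, j + 2) = v (i + 1, j + 2) - v (i + 1, j + 1) := by
      simp only [mm3, add_assoc, Nat.reduceAdd] at h₃
      linarith
    have e₂ : v (i, j + 2) - v (i, j + 1) = v (i + 1, j + 2) - v (i + 1, j + 1) := by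
      simp only [mm2, add_assoc, Nat.reduceAdd] at h₂
      linarith
    have r : Q.mu2 Q.bMax * mm3 v i (j + 1) = 0 := by rw [h₃, mul_zero]
    have a₂ := hm.mm2 (i + 1) j
    have a₃ := hm.mm3 (i + 1) j
    have e₃ := hv.mm2_eq_zero h₂
    have e₄ := (hv.mm3_eq_zero h₃).1
    -- The vanishing `T2` term equates `gain2` at two consecutive increments of `v (i + 1, ·)`:
    -- either these coincide and the induction hypothesis applies, or `gain2` is flat between them.
    rcases eq_or_ne (mm2 v (i + 1) j + mm3 v (i + 1) j) 0 with h | h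
    · exact ih (i + 1) (by linarith) (by linarith)
    · have pos : 0 < mm2 v (i + 1) j + mm3 v (i + 1) j :=
        lt_of_le_of_ne (add_nonneg a₂ a₃) h.symm
      refine key i (j + 1) h₂ h₃ (hφ.eq_zero_of_flat (a := v (i + 1, j + 1) - v (i + 1, j)) ?_ ?_)
      · unfold mm2 mm3 at pos
        simp only [add_assoc, Nat.reduceAdd] at *
        linarith
      · simp only [mm3, T2_succ, add_assoc, Nat.reduceAdd] at b r ⊢
        rw [e₁, e₂] at b
        linarith

end IsRelativeValueFunction

/-! ### Value iteration when a holding cost vanishes -/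

/-- Without holding costs at node 2 the value functions ignore the length of the second queue. -/
theorem V_eq_of_h2_eq_zero (hh : Q.h2 = 0) (n : ℕ) :
    ∀ i j, Q.V n (i, j + 1) = Q.V n (i, j) := by
  induction n with
  | zero => intro i j; rfl
  | succ n ih =>
    have t₂ : ∀ i j, Q.T2 (Q.V n) (i, j) = Q.mu2 Q.bMax * Q.V n (i, j) := by
      rintro i (_ | j)
      · rw [T2_zero]
      · rw [T2_succ, ih, sub_self, Q.isGain2.zero, sub_zero]
    have t₁ : ∀ i j, Q.T1 (Q.V n) (i, j + 1) = Q.T1 (Q.V n) (i, j) := by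
      rintro (_ | i) j
      · rw [T1_zero, T1_zero, ih]
      · rw [T1_succ, T1_succ, ih, ih]
    intro i j
    change Q.T (Q.V n) _ = Q.T (Q.V n) _
    rw [T_apply, T_apply, t₁, t₂, t₂, ih, ih, hh]
    ring

/-- Without holding costs at node 1 the value functions ignore the length of the first queue. -/
theorem V_of_h1_eq_zero (hh : Q.h1 = 0) (n : ℕ) : ∀ i j,
    Q.V n (i + 1, j) = Q.V n (i, j) ∧ Q.V n (i, j) ≤ Q.V n (i, j + 1) := by
  induction n with
  | zero => intro i j; exact ⟨rfl, le_rfl⟩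
  | succ n ih =>
    have t₁ : ∀ i j, Q.T1 (Q.V n) (i, j) = Q.mu1 Q.aMax * Q.V n (i, j) := by
      rintro (_ | i) j
      · rw [T1_zero]
      · rw [T1_succ, Q.isGain1.eq_zero_of_nonpos, sub_zero]
        rw [(ih i j).1]
        linarith [(ih i j).2]
    have t₂ : ∀ i j, Q.T2 (Q.V n) (i + 1, j) = Q.T2 (Q.V n) (i, j) := by
      rintro i (_ | j)
      · rw [T2_zero, T2_zero, (ih _ _).1]
      · rw [T2_succ, T2_succ, (ih _ _).1, (ih _ _).1]
    have t₂' : ∀ i j, Q.T2 (Q.V n) (i, j) ≤ Q.T2 (Q.V n) (i, j + 1) := by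
      intro i j
      have k := Q.isGain2.lip 0 (Q.V n (i, j + 1) - Q.V n (i, j)) (sub_nonneg.2 (ih i j).2)
      rw [Q.isGain2.zero] at k
      have : Q.T2 (Q.V n) (i, j) ≤ Q.mu2 Q.bMax * Q.V n (i, j) := by
        cases j with
        | zero => rw [T2_zero]
        | succ j => rw [T2_succ]; exact sub_le_self _ (Q.isGain2.nonneg _)
      rw [T2_succ]
      linarith
    intro i j
    change Q.T (Q.V n) _ = Q.T (Q.V n) _ ∧ Q.T (Q.V n) _ ≤ Q.T (Q.V n) _
    rw [T_apply, T_apply, T_apply]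
    constructor
    · rw [t₁, t₁, t₂, (ih (i + 1) j).1, (ih i j).1, hh]
      ring
    · rw [t₁, t₁]
      have k₁ := mul_le_mul_of_nonneg_left (ih (i + 1) j).2 Q.lam_pos.le
      have k₂ := mul_le_mul_of_nonneg_left (ih i j).2 Q.mu1_max_nonneg
      have k₃ := t₂' i j
      have k₄ := Q.h2_nonneg
      push_cast
      linarith

end TandemQueue

/-! ### Monotonicity of the optimal allocations -/

theorem theorem1 (Q : TandemQueue) (v : TandemQueue.State → ℝ) (g : ℝ)
    (hv : Q.IsRelativeValueFunction v g) :
    (∀ (x : TandemQueue.State) (b₁ b₂ : ℝ),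
      b₁ ∈ Q.argT2 v (x + TandemQueue.e₂) → b₂ ∈ Q.argT2 v x → b₁ ≥ b₂) ∧
    (∀ (x : TandemQueue.State) (a₁ a₂ : ℝ),
      a₁ ∈ Q.argT1 v (x + TandemQueue.e₁) → a₂ ∈ Q.argT1 v x → a₁ ≥ a₂) := by
  have hm := hv.multimodular
  constructor
  · rintro ⟨i, j⟩ b₁ b₂ ⟨h₁, m₁⟩ ⟨h₂, m₂⟩
    by_contra! hlt
    obtain ⟨k₁, k₂⟩ := TandemQueue.minimizers_lt (p' := v (i, j)) (q' := v (i, j + 1))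
      Q.mu2_strictMono Q.c2_strictMono h₁ h₂ m₁ m₂ hlt
    -- At an empty node the transition is a dummy one, worth exactly zero, against `k₂`.
    cases j with
    | zero => exact lt_irrefl _ (k₂.trans_eq (sub_self _))
    | succ j =>
      change v (i, j + 2) - v (i, j + 1) ≤ v (i, j + 1) - v (i, j) at k₁
      change 0 < v (i, j + 1) - v (i, j) at k₂
      rcases Q.h2_nonneg.eq_or_lt with hh | hh
      · have := hv.le_of_V_le fun n => (TandemQueue.V_eq_of_h2_eq_zero hh.symm n i j).le
        linarith
      · have a₂ := hm.mm2 i j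
        have a₃ := hm.mm3 i j
        -- `mm2 + mm3` is the second difference of `v` in the second coordinate.
        have s : TandemQueue.mm2 v i j + TandemQueue.mm3 v i j ≤ 0 := by
          unfold TandemQueue.mm2 TandemQueue.mm3
          linarith
        exact hv.mm2_mm3_ne_zero hh j i (by linarith) (by linarith)
  · rintro ⟨i, j⟩ a₁ a₂ ⟨h₁, m₁⟩ ⟨h₂, m₂⟩
    by_contra! hlt
    obtain ⟨k₁, k₂⟩ := TandemQueue.minimizers_lt (p' := v (i, j + 1)) (q' := v (i + 1, j))
      Q.mu1_strictMono Q.c1_strictMono h₁ h₂ m₁ m₂ hlt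
    cases i with
    | zero => exact lt_irrefl _ (k₂.trans_eq (sub_self _))
    | succ i =>
      change v (i + 2, j) - v (i + 1, j + 1) ≤ v (i + 1, j) - v (i, j + 1) at k₁
      change 0 < v (i + 1, j) - v (i, j + 1) at k₂
      rcases Q.h1_nonneg.eq_or_lt with hh | hh
      · have := hv.le_of_V_le fun n =>
          ((TandemQueue.V_of_h1_eq_zero hh.symm n i j).1.le.trans
            (TandemQueue.V_of_h1_eq_zero hh.symm n i j).2)
        linarith
      · refine hv.mm1_ne_zero hh j i (le_antisymm ?_ (hm.mm1 i j))
        unfold TandemQueue.mm1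
        linarith
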